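/- Let $G$ be a connected Lie group with Lie algebra $\mathfrak g=T_eG$, $\dim G=3$, let $\mathfrak p\subset\mathfrak g$ be a vector subspace with $\dim\mathfrak p\ge 2$ which generates $\mathfrak g$ (that is, $\mathfrak p^1+\dots+\mathfrak p^m=\mathfrak g$ for some $m$, where $\mathfrak p^1=\mathfrak p$ and $\mathfrak p^{k+1}=[\mathfrak p,\mathfrak p^k]$ is the span of the brackets $[v,w]$, $v\in\mathfrak p$, $w\in\mathfrak p^k$), and let $F$ be a norm on $\mathfrak p$ with closed unit ball $U=\{u\in\mathfrak p: F(u)\le 1\}$. Consider the time-optimal problem for the control system $\dot g=(dl_g)(u)$, $u\in U$, where $l_g$ is the left translation by $g$, and its Hamiltonian $H(g,\psi,u)=\psi((dl_g)(u))$, $g\in G$, $\psi\in T_g^*G$, $u\in\mathfrak g$. Let $J\subset\mathbb R$ be an interval (for instance $J=\mathbb R$). Let $g:J\to G$ be a (locally) absolutely continuous curve which is an extremal, i.e. satisfies the Pontryagin maximum principle for this problem, with a measurable control $u:J\to U$ and a nowhere vanishing covector function $\psi(t)\in T^*_{g(t)}G$ which is (locally) absolutely continuous when identified with a function with values in $\mathfrak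 g^*$ by left translations: for almost all $t\in J$, $$\dot g=\frac{\partial H}{\partial\psi}=(dl_{g})(u),\qquad \dot\psi=-\frac{\partial H}{\partial g}\ \text{(in canonical coordinates on } T^*G),\qquad H(g(t),\psi(t),u(t))=\max_{v\in U}H(g(t),\psi(t),v).$$ Assume that the curve $g$ is not constant. Then the extremal is normal and not abnormal, whatever the choice of $u$ and $\psi$: the function $t\mapsto\max_{v\in U}H(g(t),\psi(t),v)$ is equal on $J$ to a constant $M_0$, and $M_0>0$ (abnormal would mean $M_0=0$). -/

import Mathlib

open scoped Manifold ContDiff Topology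
open MeasureTheory Set

noncomputable section

namespace SubFinsler

section LieAlgebraGeneration

variable {L : Type*} [AddCommGroup L] [Module ℝ L] [Bracket L L]

/-- The subspaces `𝔭¹ = 𝔭`, `𝔭ᵏ⁺¹ = [𝔭, 𝔭ᵏ]`, where `[𝔭, 𝔮]` is the subspace spanned by the brackets
`[v, w]`, `v ∈ 𝔭`, `w ∈ 𝔮`. The index is shifted by one: `bracketPower 𝔭 k` is `𝔭ᵏ⁺¹`. -/
def bracketPower (p : Submodule ℝ L) : ℕ → Submodule ℝ L
  | 0 => p
  | k + 1 => Submodule.span ℝ {x | ∃ v ∈ p, ∃ w ∈ bracketPower p k, x = ⁅v, w⁆}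

/-- `𝔭` generates the Lie algebra: the sum `𝔭¹ + ⋯ + 𝔭ᵐ` is everything for some `m`. -/
def Generates (p : Submodule ℝ L) : Prop :=
  ∃ m : ℕ, ⨆ k ∈ Finset.range m, bracketPower p k = ⊤

end LieAlgebraGeneration

variable {E : Type*} [NormedAddCommGroup E] [NormedSpace ℝ E]
  {G : Type*} [TopologicalSpace G] [ChartedSpace E G] [Group G]

/-- The control region `U = {u ∈ 𝔭 : F(u) ≤ 1}`. -/
def controlRegion {p : Submodule ℝ (GroupLieAlgebra 𝓘(ℝ, E) G)} (F : Seminorm ℝ p) :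
    Set (GroupLieAlgebra 𝓘(ℝ, E) G) :=
  {v | ∃ hv : v ∈ p, F ⟨v, hv⟩ ≤ 1}

/-- The Hamiltonian `H(g, ψ, u) = ψ((dl_g)(u))` of the time-optimal problem, for a point `g` of
the group, a covector `ψ ∈ T*_g G` and a vector `u` of the Lie algebra. -/
def hamiltonian (g : G) (ψ : TangentSpace 𝓘(ℝ, E) g →L[ℝ] ℝ)
    (u : GroupLieAlgebra 𝓘(ℝ, E) G) : ℝ :=
  ψ (mulInvariantVectorField u g)

/-- The Hamiltonian in the canonical coordinates `(x, q)` on the cotangent bundle which come from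
the chart of `G` around `x₀`: it is `H(g, ψ, u)` for the covector `ψ = ∑ qᵢ dxⁱ` at the point `g`
with coordinates `x`. -/
def chartHamiltonian (x₀ : G) (u : GroupLieAlgebra 𝓘(ℝ, E) G) (x : E) (q : E →L[ℝ] ℝ) : ℝ :=
  hamiltonian ((extChartAt 𝓘(ℝ, E) x₀).symm x)
    (q.comp (mfderiv 𝓘(ℝ, E) 𝓘(ℝ, E) (extChartAt 𝓘(ℝ, E) x₀)
      ((extChartAt 𝓘(ℝ, E) x₀).symm x))) u

/-- The momentum coordinates `q` of the covector `ψ ∈ T*_g G` in the chart around `x₀`, that is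
`ψ = q ∘ dφ_g` where `φ` is the chart (whose domain contains `g`). -/
def momentum (x₀ g : G) (ψ : TangentSpace 𝓘(ℝ, E) g →L[ℝ] ℝ) : E →L[ℝ] ℝ :=
  ψ.comp (mfderiv 𝓘(ℝ, E) 𝓘(ℝ, E) (extChartAt 𝓘(ℝ, E) x₀) g).inverse

/-- A curve in `G` is (locally) absolutely continuous on the interval `J`: it is continuous, and its
expression in each chart is absolutely continuous on every compact subinterval which the curve
sends to the domain of the chart. -/
def LocallyAbsolutelyContinuousOn (g : ℝ → G) (J : Set ℝ) : Prop :=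
  ContinuousOn g J ∧
    ∀ (x₀ : G) (a b : ℝ), a ≤ b → Icc a b ⊆ J →
      MapsTo g (Icc a b) (extChartAt 𝓘(ℝ, E) x₀).source →
        AbsolutelyContinuousOnInterval (fun t => extChartAt 𝓘(ℝ, E) x₀ (g t)) a b

/-- The curve `g`, with control `u` and covector function `ψ(t) ∈ T*_{g(t)} G`, satisfies on the
time interval `J` the Pontryagin maximum principle for the time-optimal problem of the control
system `ġ = (dl_g)(u)`, `u ∈ U = {u ∈ 𝔭 : F(u) ≤ 1}`. -/
structure IsExtremal {p : Submodule ℝ (GroupLieAlgebra 𝓘(ℝ, E) G)} (F : Seminorm ℝ p) (J : Set ℝ)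
    (g : ℝ → G) (u : ℝ → GroupLieAlgebra 𝓘(ℝ, E) G)
    (ψ : ∀ t : ℝ, TangentSpace 𝓘(ℝ, E) (g t) →L[ℝ] ℝ) : Prop where
  /-- the control is measurable -/
  measurable_control : AEStronglyMeasurable u (volume.restrict J)
  /-- the control takes values in the control region -/
  control_mem : ∀ t ∈ J, u t ∈ controlRegion F
  /-- the trajectory is absolutely continuous -/
  absolutelyContinuous : LocallyAbsolutelyContinuousOn (E := E) g J
  /-- the control system `ġ = (dl_g)(u)`, which is also the equation `ġ = ∂H/∂ψ` -/
  velocity : ∀ᵐ t, t ∈ J →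
    HasMFDerivAt 𝓘(ℝ, ℝ) 𝓘(ℝ, E) g t
      ((1 : ℝ →L[ℝ] ℝ).smulRight (mulInvariantVectorField (u t) (g t)))
  /-- the covector function does not vanish -/
  covector_ne_zero : ∀ t ∈ J, ψ t ≠ 0
  /-- the covector function, identified with a function with values in the dual of the Lie algebra
  by left translations, is absolutely continuous -/
  covector_absolutelyContinuous : ∀ (v : GroupLieAlgebra 𝓘(ℝ, E) G) (a b : ℝ), a ≤ b →
    Icc a b ⊆ J → AbsolutelyContinuousOnInterval (fun t => ψ t (mulInvariantVectorField v (g t))) a b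
  /-- the adjoint equation `ψ̇ = -∂H/∂g`, in the canonical coordinates of each chart -/
  adjoint : ∀ᵐ t, t ∈ J → ∀ x₀ : G, g t ∈ (extChartAt 𝓘(ℝ, E) x₀).source →
    HasDerivAt (fun s => momentum x₀ (g s) (ψ s))
      (-(fderiv ℝ (fun x => chartHamiltonian x₀ (u t) x (momentum x₀ (g t) (ψ t)))
        (extChartAt 𝓘(ℝ, E) x₀ (g t)))) t
  /-- the maximum condition -/
  maximum : ∀ᵐ t, t ∈ J → ∀ v ∈ controlRegion F,
    hamiltonian (g t) (ψ t) v ≤ hamiltonian (g t) (ψ t) (u t)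

/-- The maximized Hamiltonian `H(t) = max_{v ∈ U} H(g(t), ψ(t), v)` has the constant value `M₀`
along the curve. -/
def HasHamiltonianValue {p : Submodule ℝ (GroupLieAlgebra 𝓘(ℝ, E) G)} (F : Seminorm ℝ p)
    (J : Set ℝ) (g : ℝ → G) (ψ : ∀ t : ℝ, TangentSpace 𝓘(ℝ, E) (g t) →L[ℝ] ℝ) (M₀ : ℝ) : Prop :=
  ∀ t ∈ J, IsGreatest (hamiltonian (g t) (ψ t) '' controlRegion F) M₀

/-- Normal: `H(t) = M₀` for a constant `M₀ > 0`. -/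
def IsNormal {p : Submodule ℝ (GroupLieAlgebra 𝓘(ℝ, E) G)} (F : Seminorm ℝ p)
    (J : Set ℝ) (g : ℝ → G) (ψ : ∀ t : ℝ, TangentSpace 𝓘(ℝ, E) (g t) →L[ℝ] ℝ) : Prop :=
  ∃ M₀ : ℝ, 0 < M₀ ∧ HasHamiltonianValue F J g ψ M₀

/-- Abnormal: `H(t) = M₀` with `M₀ = 0`. -/
def IsAbnormal {p : Submodule ℝ (GroupLieAlgebra 𝓘(ℝ, E) G)} (F : Seminorm ℝ p)
    (J : Set ℝ) (g : ℝ → G) (ψ : ∀ t : ℝ, TangentSpace 𝓘(ℝ, E) (g t) →L[ℝ] ℝ) : Prop :=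
  HasHamiltonianValue F J g ψ 0

end SubFinsler

end

/-! Left translation turns `ψ(t)` into a functional λ(t) on the Lie algebra (`bodyCovector`), and
the adjoint equation becomes λ̇(v) = λ([u, v]) (`hasDerivAt_hamiltonian`). As [u, u] = 0, λ is
stationary along its own maximizer u(t), so by an envelope argument the maximum M of λ over U is
constant (`exists_const_isGreatest`); M ≥ 0 because 0 ∈ U. Suppose M = 0. Then λ(t) vanishes on p
for every t, and differentiating gives λ([u, v]) = 0 for all v in p. Since λ ≠ 0, dimensions force p
= ker λ. If u ≠ 0, a basis u, w of p shows that [p, p] is spanned by [u, w] ∈ ker λ = p, so p is a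
proper subalgebra and cannot generate (`eq_zero_of_functional_lie_eq_zero`). Hence u = 0 almost
everywhere and the curve is constant, contrary to assumption. -/

noncomputable section

namespace SubFinsler

/-! ### Maxima of linear functionals over a unit ball -/

section Support

variable {V : Type*} [AddCommGroup V] [Module ℝ V] [FiniteDimensional ℝ V]

/-- A linear functional attains its maximum over the closed unit ball of a norm on a
finite-dimensional space. -/
lemma exists_isMaxOn_unitBall (F : Seminorm ℝ V) (hF : ∀ v, F v = 0 → v = 0) (l : V →ₗ[ℝ] ℝ) :
    ∃ v, F v ≤ 1 ∧ ∀ w, F w ≤ 1 → l w ≤ l v := by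
  let _ : NormedAddCommGroup V := AddGroupNorm.toNormedAddCommGroup
    { F.toAddGroupSeminorm with eq_zero_of_map_eq_zero' := hF }
  have hn : ∀ v : V, ‖v‖ = F v := fun _ => rfl
  let _ : NormedSpace ℝ V := ⟨fun a b => by rw [hn, hn, map_smul_eq_mul]⟩
  have : ProperSpace V := FiniteDimensional.proper ℝ V
  obtain ⟨v, hv, hmax⟩ := (isCompact_closedBall (0 : V) 1).exists_isMaxOn
    ⟨0, by simp⟩ l.continuous_of_finiteDimensional.continuousOn
  refine ⟨v, by simpa [hn] using hv, fun w hw => hmax (by simpa [hn] using hw)⟩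

/-- Linear functionals are bounded on the closed unit ball of a norm. -/
lemma exists_abs_le_of_unitBall (F : Seminorm ℝ V) (hF : ∀ v, F v = 0 → v = 0) (l : V →ₗ[ℝ] ℝ) :
    ∃ B, ∀ w, F w ≤ 1 → |l w| ≤ B := by
  obtain ⟨v, -, hmax⟩ := exists_isMaxOn_unitBall F hF l
  refine ⟨l v, fun w hw => abs_le.2 ⟨?_, hmax w hw⟩⟩
  have := hmax (-w) (by rwa [map_neg_eq_map])
  rw [map_neg] at this
  linarith

/-- A functional which is nonpositive on the closed unit ball of a seminorm vanishes. -/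
lemma eq_zero_of_nonpos_unitBall {V : Type*} [AddCommGroup V] [Module ℝ V]
    (F : Seminorm ℝ V) (l : V →ₗ[ℝ] ℝ)
    (h : ∀ w, F w ≤ 1 → l w ≤ 0) : l = 0 := by
  have key : ∀ v, l v ≤ 0 := by
    intro v
    -- Scaling by 1 + F v rather than F v also covers F v = 0.
    have hpos : 0 < 1 + F v := by have := apply_nonneg F v; linarith
    have := h ((1 + F v)⁻¹ • v) (by
      rw [map_smul_eq_mul, Real.norm_of_nonneg (inv_nonneg.2 hpos.le), inv_mul_le_one₀ hpos]
      linarith)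
    rw [map_smul, smul_eq_mul] at this
    exact nonpos_of_mul_nonpos_right this (inv_pos.2 hpos)
  ext v
  have h1 := key v
  have h2 := key (-v)
  rw [map_neg] at h2
  simpa using le_antisymm h1 (by linarith)

/-- A function is absolutely continuous if its increments are dominated by those of finitely many
absolutely continuous functions. -/
lemma AbsolutelyContinuousOnInterval.of_dist_le_sum {ι : Type*} [Fintype ι] {f : ℝ → ℝ}
    {h : ι → ℝ → ℝ} {B : ι → ℝ} {a b : ℝ}
    (hh : ∀ i, AbsolutelyContinuousOnInterval (h i) a b)
    (hf : ∀ s t, dist (f s) (f t) ≤ ∑ i, B i * dist (h i s) (h i t)) :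
    AbsolutelyContinuousOnInterval f a b := by
  have hsum := tendsto_finsetSum Finset.univ
    (fun i _ => (show Filter.Tendsto _ _ _ from hh i).const_mul (B i))
  simp only [mul_zero, Finset.sum_const_zero] at hsum
  refine squeeze_zero (fun t => Finset.sum_nonneg fun i _ => dist_nonneg) (fun t => ?_) hsum
  refine (Finset.sum_le_sum fun i _ => hf _ _).trans (le_of_eq ?_)
  rw [Finset.sum_comm]
  simp [Finset.mul_sum]

/-- The maximum over the unit ball of an absolutely continuous family of functionals is constant,
if at almost every time the functional has zero derivative along a maximizer. -/
lemma exists_const_isGreatest (F : Seminorm ℝ V) (hF : ∀ v, F v = 0 → v = 0)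
    {J : Set ℝ} (hJ : J.OrdConnected) (hne : J.Nonempty) (l : ℝ → V →ₗ[ℝ] ℝ)
    (hac : ∀ v a b, a ≤ b → Icc a b ⊆ J → AbsolutelyContinuousOnInterval (fun t => l t v) a b)
    (hmax : ∀ᵐ t, t ∈ J → ∃ w, F w ≤ 1 ∧ (∀ v, F v ≤ 1 → l t v ≤ l t w) ∧
      HasDerivAt (fun s => l s w) 0 t) :
    ∃ M, ∀ t ∈ J, IsGreatest (l t '' {v | F v ≤ 1}) M := by
  choose v hv hvmax using fun t => exists_isMaxOn_unitBall F hF (l t)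
  let e := Module.finBasis ℝ V
  choose B hB using fun i => exists_abs_le_of_unitBall F hF (e.coord i)
  let M : ℝ → ℝ := fun t => l t (v t)
  -- The maximizer at time s competes at time t. Its coordinates are bounded uniformly in s, so M
  -- inherits absolute continuity from the finitely many functions l(·)(e i).
  have hM1 : ∀ s t, M s - M t ≤ ∑ i, B i * dist (l s (e i)) (l t (e i)) := by
    intro s t
    calc M s - M t ≤ (l s - l t) (v s) := by
          have := hvmax t (v s) (hv s)
          simp only [M, LinearMap.sub_apply]; linarith
      _ = ∑ i, e.coord i (v s) * (l s (e i) - l t (e i)) := by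
          have := congrArg (l s - l t) (e.sum_repr (v s))
          rw [map_sum] at this
          simpa using this.symm
      _ ≤ _ := Finset.sum_le_sum fun i _ => by
          refine (le_abs_self _).trans ?_
          rw [abs_mul, Real.dist_eq]
          exact mul_le_mul_of_nonneg_right (hB i _ (hv s)) (abs_nonneg _)
  have hMac : ∀ a b, a ≤ b → Icc a b ⊆ J → AbsolutelyContinuousOnInterval M a b := by
    intro a b hab hsub
    refine AbsolutelyContinuousOnInterval.of_dist_le_sum (B := B)
      (fun i => hac (e i) a b hab hsub) fun s t => ?_
    rw [Real.dist_eq, abs_le]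
    refine ⟨?_, hM1 s t⟩
    have := hM1 t s
    simp only [dist_comm (l t _)] at this
    linarith
  have hconst : ∀ a ∈ J, ∀ b ∈ J, a ≤ b → M a = M b := by
    intro a ha b hb hab
    have hsub := hJ.out ha hb
    have hMab := hMac a b hab hsub
    obtain ⟨C, hC⟩ := hMab.const_of_ae_hasDerivAt_zero (by
      filter_upwards [hmax, hMab.ae_differentiableAt] with t ht hd htab
      have htJ := hsub (by rwa [uIcc_of_le hab] at htab)
      obtain ⟨w, hw, hwm, hwd⟩ := ht htJ
      have hd' := (hd htab).hasDerivAt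
      -- Envelope argument: w is admissible at every time and optimal at t, so M - l(·)w is
      -- nonnegative and vanishes at t.
      have hmin : IsLocalMin (fun s => M s - l s w) t := by
        refine Filter.Eventually.of_forall fun s => ?_
        have h1 : M t = l t w := le_antisymm (hwm _ (hv t)) (hvmax t w hw)
        have h2 := hvmax s w hw
        simp only [h1, M] at *
        linarith
      have h0 := hmin.hasDerivAt_eq_zero (hd'.sub hwd)
      rw [sub_zero] at h0
      rwa [h0] at hd')
    rw [hC a left_mem_uIcc, hC b right_mem_uIcc]
  obtain ⟨t₀, ht₀⟩ := hne
  refine ⟨M t₀, fun t ht => ?_⟩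
  have : M t₀ = M t := by
    rcases le_total t₀ t with h | h
    · exact hconst _ ht₀ _ ht h
    · exact (hconst _ ht _ ht₀ h).symm
  rw [this]
  exact ⟨⟨v t, hv t, rfl⟩, by rintro _ ⟨w, hw, rfl⟩; exact hvmax t w hw⟩

end Support

/-! ### Generating planes in a three-dimensional Lie algebra -/

section Algebra

variable {L : Type*} [LieRing L] [LieAlgebra ℝ L]

/-- A proper subspace closed under brackets does not generate. -/
lemma not_generates_of_lie_mem {p : Submodule ℝ L} (hp : p ≠ ⊤)
    (h : ∀ v ∈ p, ∀ w ∈ p, ⁅v, w⁆ ∈ p) : ¬ Generates p := by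
  rintro ⟨m, hm⟩
  have hk : ∀ k, bracketPower p k ≤ p := by
    intro k
    induction k with
    | zero => exact le_rfl
    | succ k ih =>
      refine Submodule.span_le.2 ?_
      rintro _ ⟨v, hv, w, hw, rfl⟩
      exact h v hv w (ih hw)
  exact hp (top_le_iff.1 (hm ▸ iSup₂_le fun k _ => hk k))

/-- If a generating plane `p` in a three-dimensional Lie algebra is annihilated by a nonzero
functional `l`, then `l` does not annihilate `[u, p]` for nonzero `u ∈ p`. -/
lemma eq_zero_of_functional_lie_eq_zero (hdim : Module.finrank ℝ L = 3) {p : Submodule ℝ L}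
    (hp : Generates p) (hp2 : 2 ≤ Module.finrank ℝ p) {l : L →ₗ[ℝ] ℝ} (hl : l ≠ 0)
    (hlp : ∀ v ∈ p, l v = 0) {u : L} (hu : u ∈ p) (hlu : ∀ v ∈ p, l ⁅u, v⁆ = 0) : u = 0 := by
  have : FiniteDimensional ℝ L := FiniteDimensional.of_finrank_pos (by omega)
  by_contra hu0
  have hker : p ≤ LinearMap.ker l := hlp
  have hltop : LinearMap.ker l ≠ ⊤ := fun h => hl (LinearMap.ker_eq_top.1 h)
  have hlt := Submodule.finrank_lt hltop
  have hle := Submodule.finrank_mono hker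
  -- 2 ≤ dim p ≤ dim ker l < 3.
  have hpk : p = LinearMap.ker l := Submodule.eq_of_le_of_finrank_le hker (by omega)
  have hfp : Module.finrank ℝ p = 2 := by omega
  let u' : p := ⟨u, hu⟩
  have hu' : u' ≠ 0 := fun h => hu0 (congrArg Subtype.val h)
  obtain ⟨w, hw⟩ : ∃ w : p, w ∉ Submodule.span ℝ {u'} := by
    by_contra! h
    have htop : Submodule.span ℝ {u'} = ⊤ := by ext; simp [h]
    have := finrank_span_singleton (K := ℝ) hu'
    rw [htop, finrank_top] at this
    omega
  have hind : LinearIndependent ℝ ![u', w] := by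
    rw [LinearIndependent.pair_iff' hu']
    intro a h
    exact hw (h ▸ Submodule.smul_mem _ _ (Submodule.mem_span_singleton_self _))
  have hspan : Submodule.span ℝ {u', w} = ⊤ := by
    have := hind.span_eq_top_of_card_eq_finrank' (by simp [hfp])
    simpa [pair_comm] using this
  have hrep : ∀ v ∈ p, ∃ a b : ℝ, v = a • u + b • (w : L) := by
    intro v hv
    have : (⟨v, hv⟩ : p) ∈ Submodule.span ℝ {u', w} := hspan ▸ Submodule.mem_top
    obtain ⟨a, b, hab⟩ := Submodule.mem_span_pair.1 this
    exact ⟨a, b, (congrArg Subtype.val hab).symm⟩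
  -- It remains to see that l kills [p, p]; bilinearity and antisymmetry reduce this to [u, w].
  refine not_generates_of_lie_mem (p := p) (hpk ▸ hltop) (fun x hx y hy => ?_) hp
  rw [hpk, LinearMap.mem_ker]
  obtain ⟨a, b, rfl⟩ := hrep x hx
  have h2 : l ⁅(w : L), y⁆ = 0 := by
    obtain ⟨c, d, rfl⟩ := hrep y hy
    have hwu : l ⁅(w : L), u⁆ = 0 := by rw [← lie_skew, map_neg, hlu w w.2, neg_zero]
    rw [lie_add, lie_smul, lie_smul, lie_self]
    simp [hwu]
  rw [add_lie, smul_lie, smul_lie, map_add, map_smul, map_smul, hlu y hy, h2]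
  simp

end Algebra

/-! ### Vector fields and their brackets in a chart -/

section Manifold
open VectorField

variable {E : Type*} [NormedAddCommGroup E] [NormedSpace ℝ E]
  {G : Type*} [TopologicalSpace G] [ChartedSpace E G]

section Field
variable [IsManifold 𝓘(ℝ, E) 2 G]

/-- The expression of a vector field in the chart around `x₀`. -/
def chartField (x₀ : G) (V : ∀ x : G, TangentSpace 𝓘(ℝ, E) x) (x : E) : E :=
  mfderiv 𝓘(ℝ, E) 𝓘(ℝ, E) (extChartAt 𝓘(ℝ, E) x₀) ((extChartAt 𝓘(ℝ, E) x₀).symm x)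
    (V ((extChartAt 𝓘(ℝ, E) x₀).symm x))

/-- The pullback applies the inverse of the derivative of the inverse chart, which is the derivative
of the chart. This links `chartField` to the definition of `mlieBracket`. -/
lemma mpullbackWithin_extChartAt_symm_apply (x₀ : G) (V : ∀ x : G, TangentSpace 𝓘(ℝ, E) x) {x : E}
    (hx : x ∈ (extChartAt 𝓘(ℝ, E) x₀).target) :
    mpullbackWithin 𝓘(ℝ, E) 𝓘(ℝ, E) (extChartAt 𝓘(ℝ, E) x₀).symm V (range 𝓘(ℝ, E)) x
      = chartField x₀ V x := by
  have : IsManifold 𝓘(ℝ, E) 1 G := IsManifold.of_le (n := 2) (by norm_num)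
  rw [mpullbackWithin_apply, chartField]
  congr 1
  exact ContinuousLinearMap.inverse_eq
    (mfderivWithin_extChartAt_symm_comp_mfderiv_extChartAt hx)
    (mfderiv_extChartAt_comp_mfderivWithin_extChartAt_symm hx)

lemma mpullbackWithin_extChartAt_symm_eventuallyEq (x₀ : G) (V : ∀ x : G, TangentSpace 𝓘(ℝ, E) x) :
    mpullbackWithin 𝓘(ℝ, E) 𝓘(ℝ, E) (extChartAt 𝓘(ℝ, E) x₀).symm V (range 𝓘(ℝ, E))
      =ᶠ[𝓝 (extChartAt 𝓘(ℝ, E) x₀ x₀)] chartField x₀ V := by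
  filter_upwards [extChartAt_target_mem_nhds x₀] with x hx
  exact mpullbackWithin_extChartAt_symm_apply x₀ V hx

lemma differentiableAt_chartField [CompleteSpace E] {x₀ : G}
    {V : ∀ x : G, TangentSpace 𝓘(ℝ, E) x}
    (hV : MDifferentiableAt 𝓘(ℝ, E) 𝓘(ℝ, E).tangent
      (fun x => (⟨x, V x⟩ : TangentBundle 𝓘(ℝ, E) G)) x₀) :
    DifferentiableAt ℝ (chartField x₀ V) (extChartAt 𝓘(ℝ, E) x₀ x₀) := by
  have h := hV.mdifferentiableWithinAt (s := univ)
    |>.differentiableWithinAt_mpullbackWithin_vectorField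
  simp only [preimage_univ, modelWithCornersSelf_coe, range_id, inter_univ]
    at h
  refine (show DifferentiableAt ℝ _ _ from
    differentiableWithinAt_univ.1 h).congr_of_eventuallyEq ?_
  simpa using (mpullbackWithin_extChartAt_symm_eventuallyEq x₀ V).symm

/-- The Lie bracket of vector fields computed in the chart. -/
lemma mfderiv_extChartAt_mlieBracket (x₀ : G) (V W : ∀ x : G, TangentSpace 𝓘(ℝ, E) x) :
    mfderiv 𝓘(ℝ, E) 𝓘(ℝ, E) (extChartAt 𝓘(ℝ, E) x₀) x₀ (mlieBracket 𝓘(ℝ, E) V W x₀) =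
      fderiv ℝ (chartField x₀ W) (extChartAt 𝓘(ℝ, E) x₀ x₀)
          (chartField x₀ V (extChartAt 𝓘(ℝ, E) x₀ x₀)) -
        fderiv ℝ (chartField x₀ V) (extChartAt 𝓘(ℝ, E) x₀ x₀)
          (chartField x₀ W (extChartAt 𝓘(ℝ, E) x₀ x₀)) := by
  have : IsManifold 𝓘(ℝ, E) 1 G := IsManifold.of_le (n := 2) (by norm_num)
  have hinv := isInvertible_mfderiv_extChartAt (I := 𝓘(ℝ, E)) (mem_extChartAt_source (I := 𝓘(ℝ, E)) x₀)
  rw [← mlieBracketWithin_univ, mlieBracketWithin_apply]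
  refine (hinv.self_apply_inverse _).trans ?_
  have h := Filter.EventuallyEq.lieBracket_vectorField_eq (𝕜 := ℝ)
    (mpullbackWithin_extChartAt_symm_eventuallyEq x₀ V)
    (mpullbackWithin_extChartAt_symm_eventuallyEq x₀ W)
  rw [preimage_univ, univ_inter, modelWithCornersSelf_coe, range_id]
  rw [modelWithCornersSelf_coe, range_id] at h
  exact (congrFun (lieBracketWithin_univ (𝕜 := ℝ) (E := E)) _).trans h

end Field

end Manifold

/-! ### The adjoint equation on the Lie algebra -/

section Group

open VectorField

variable {E : Type*} [NormedAddCommGroup E] [NormedSpace ℝ E]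
  {G : Type*} [TopologicalSpace G] [ChartedSpace E G] [Group G]

omit [Group G] in
-- The chart derivative cancels against its inverse in `momentum`. This writes `ψ (V g)` as a
-- pairing in the fixed space `E`, to which the product rule applies.
lemma momentum_chartField [IsManifold 𝓘(ℝ, E) 1 G] (x₀ : G) {g : G}
    (hg : g ∈ (extChartAt 𝓘(ℝ, E) x₀).source)
    (ψ : TangentSpace 𝓘(ℝ, E) g →L[ℝ] ℝ) (V : ∀ x : G, TangentSpace 𝓘(ℝ, E) x) :
    momentum x₀ g ψ (chartField x₀ V (extChartAt 𝓘(ℝ, E) x₀ g)) = ψ (V g) := by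
  have hinv := isInvertible_mfderiv_extChartAt (I := 𝓘(ℝ, E)) hg
  unfold chartField
  rw [(extChartAt 𝓘(ℝ, E) x₀).left_inv hg]
  exact congrArg ψ (hinv.inverse_apply_self _)

lemma hamiltonian_add (g : G) (ψ : TangentSpace 𝓘(ℝ, E) g →L[ℝ] ℝ)
    (u v : GroupLieAlgebra 𝓘(ℝ, E) G) :
    hamiltonian g ψ (u + v) = hamiltonian g ψ u + hamiltonian g ψ v := by
  simp [hamiltonian, mulInvariantVectorField_add]

lemma hamiltonian_smul (g : G) (ψ : TangentSpace 𝓘(ℝ, E) g →L[ℝ] ℝ)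
    (c : ℝ) (u : GroupLieAlgebra 𝓘(ℝ, E) G) :
    hamiltonian g ψ (c • u) = c * hamiltonian g ψ u := by
  simp [hamiltonian, mulInvariantVectorField_smul]

/-- The covector `ψ ∈ T*_g G` as a functional on the Lie algebra, through left translation. -/
def bodyCovector (g : G) (ψ : TangentSpace 𝓘(ℝ, E) g →L[ℝ] ℝ) :
    GroupLieAlgebra 𝓘(ℝ, E) G →ₗ[ℝ] ℝ where
  toFun := hamiltonian g ψ
  map_add' := hamiltonian_add g ψ
  map_smul' := hamiltonian_smul g ψ

variable [LieGroup 𝓘(ℝ, E) (minSmoothness ℝ 3) G]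

/-- The derivative of translation by `g⁻¹` provides a right inverse. -/
lemma mulInvariantVectorField_surjective (g : G) :
    Function.Surjective fun v : GroupLieAlgebra 𝓘(ℝ, E) G => mulInvariantVectorField v g := by
  have h3 : minSmoothness ℝ 3 ≠ 0 := by simp
  -- The base point is kept as `g⁻¹ * g`, the form in which the chain rule produces it; it is
  -- replaced by 1 only at the end.
  have key : ∀ h : G, h = g⁻¹ * g →
      ∀ v : E, ∃ w : E, (mfderiv 𝓘(ℝ, E) 𝓘(ℝ, E) (g * ·) h : E →L[ℝ] E) w = v := by
    rintro _ rfl v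
    have h1 := ((contMDiff_mul_left (I := 𝓘(ℝ, E)) (n := minSmoothness ℝ 3)
      (a := g)).mdifferentiableAt h3 (x := g⁻¹ * g)).hasMFDerivAt
    have h2 := ((contMDiff_mul_left (I := 𝓘(ℝ, E)) (n := minSmoothness ℝ 3)
      (a := g⁻¹)).mdifferentiableAt h3 (x := g)).hasMFDerivAt
    have h12 := HasMFDerivAt.comp (I' := 𝓘(ℝ, E)) g h1 h2
    have hid : (g * ·) ∘ (g⁻¹ * ·) = (id : G → G) := by ext; simp
    rw [hid] at h12
    have := hasMFDerivAt_unique h12 (hasMFDerivAt_id g)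
    exact ⟨mfderiv 𝓘(ℝ, E) 𝓘(ℝ, E) (g⁻¹ * ·) g v, congrArg (fun f : E →L[ℝ] E => f v) this⟩
  exact key 1 (by simp)

lemma bodyCovector_ne_zero {g : G} {ψ : TangentSpace 𝓘(ℝ, E) g →L[ℝ] ℝ} (h : ψ ≠ 0) :
    bodyCovector g ψ ≠ 0 := by
  intro h0
  apply h
  ext v
  obtain ⟨w, hw⟩ := mulInvariantVectorField_surjective g v
  rw [← hw]
  exact LinearMap.congr_fun h0 w

/-- The adjoint equation in the chart gives the equation `λ̇(v) = λ([u, v])` for the covector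
transported to the Lie algebra. -/
lemma hasDerivAt_hamiltonian [FiniteDimensional ℝ E] {g : ℝ → G} {t : ℝ} {u : GroupLieAlgebra 𝓘(ℝ, E) G}
    {ψ : ∀ t : ℝ, TangentSpace 𝓘(ℝ, E) (g t) →L[ℝ] ℝ}
    (hvel : HasMFDerivAt 𝓘(ℝ, ℝ) 𝓘(ℝ, E) g t
      ((1 : ℝ →L[ℝ] ℝ).smulRight (mulInvariantVectorField u (g t))))
    (hadj : HasDerivAt (fun s => momentum (g t) (g s) (ψ s))
      (-(fderiv ℝ (fun x => chartHamiltonian (g t) u x (momentum (g t) (g t) (ψ t)))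
        (extChartAt 𝓘(ℝ, E) (g t) (g t)))) t)
    (v : GroupLieAlgebra 𝓘(ℝ, E) G) :
    HasDerivAt (fun s => hamiltonian (g s) (ψ s) v) (hamiltonian (g t) (ψ t) ⁅u, v⁆) t := by
  have h3 : minSmoothness ℝ 3 = 3 := by simp
  have : IsManifold 𝓘(ℝ, E) 3 G := h3 ▸ (inferInstance : IsManifold 𝓘(ℝ, E) (minSmoothness ℝ 3) G)
  have : IsManifold 𝓘(ℝ, E) 2 G := IsManifold.of_le (n := 3) (by norm_num)
  have : IsManifold 𝓘(ℝ, E) 1 G := IsManifold.of_le (n := 3) (by norm_num)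
  have : CompleteSpace E := FiniteDimensional.complete ℝ E
  set x₀ := g t with hx₀
  set φ := extChartAt 𝓘(ℝ, E) x₀ with hφ
  set X := chartField x₀ (mulInvariantVectorField u) with hX
  set Y := chartField x₀ (mulInvariantVectorField v) with hY
  have hXd : DifferentiableAt ℝ X (φ x₀) :=
    differentiableAt_chartField (mdifferentiableAt_mulInvariantVectorField u)
  have hYd : DifferentiableAt ℝ Y (φ x₀) :=
    differentiableAt_chartField (mdifferentiableAt_mulInvariantVectorField v)
  set q := fun s => momentum x₀ (g s) (ψ s) with hq
  have hev : (fun s => hamiltonian (g s) (ψ s) v) =ᶠ[𝓝 t] fun s => q s (Y (φ (g s))) := by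
    filter_upwards [hvel.continuousAt.preimage_mem_nhds (extChartAt_source_mem_nhds (I := 𝓘(ℝ, E)) (g t))]
      with s hs
    exact (momentum_chartField x₀ hs (ψ s) _).symm
  have hx : HasDerivAt (fun s => φ (g s)) (X (φ x₀)) t := by
    have h1 := (mdifferentiableAt_extChartAt (I := 𝓘(ℝ, E))
      (mem_chart_source E x₀)).hasMFDerivAt.comp t hvel
    let y : E := mulInvariantVectorField u x₀
    let D : E →L[ℝ] E := mfderiv 𝓘(ℝ, E) 𝓘(ℝ, E) φ x₀
    have h2 : HasFDerivAt (fun s => φ (g s)) (D.comp ((1 : ℝ →L[ℝ] ℝ).smulRight y)) t :=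
      h1.hasFDerivAt
    have hXx : X (φ x₀) = D y := by
      rw [hX, chartField, (extChartAt 𝓘(ℝ, E) x₀).left_inv (mem_extChartAt_source x₀)]
      rfl
    rw [hXx]
    simpa using h2.hasDerivAt
  have hYx : HasDerivAt (fun s => Y (φ (g s))) (fderiv ℝ Y (φ x₀) (X (φ x₀))) t :=
    HasFDerivAt.comp_hasDerivAt (f := fun s => φ (g s)) t hYd.hasFDerivAt hx
  have hprod := hadj.clm_apply hYx
  refine (hprod.congr_of_eventuallyEq hev).congr_deriv ?_
  -- With the momentum frozen, the chart Hamiltonian is x ↦ q(X(x)).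
  have hfd : fderiv ℝ (fun x => chartHamiltonian x₀ u x (momentum x₀ x₀ (ψ t))) (φ x₀)
      = (q t).comp (fderiv ℝ X (φ x₀)) :=
    ((q t).hasFDerivAt.comp (φ x₀) hXd.hasFDerivAt).fderiv
  have hbr : hamiltonian x₀ (ψ t) ⁅u, v⁆ =
      q t (fderiv ℝ Y (φ x₀) (X (φ x₀)) - fderiv ℝ X (φ x₀) (Y (φ x₀))) := by
    rw [← mfderiv_extChartAt_mlieBracket, ← mulInvariantVector_mlieBracket]
    have := momentum_chartField x₀ (mem_extChartAt_source x₀) (ψ t) (mulInvariantVectorField ⁅u, v⁆)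
    rw [chartField, (extChartAt 𝓘(ℝ, E) x₀).left_inv (mem_extChartAt_source x₀)] at this
    exact this.symm
  rw [hbr, hfd, map_sub]
  exact neg_add_eq_sub _ _

end Group

/-! ### Curves with zero velocity, and the control region -/

variable {E : Type*} [NormedAddCommGroup E] [NormedSpace ℝ E]
  {G : Type*} [TopologicalSpace G] [ChartedSpace E G]

/-- An absolutely continuous curve whose velocity vanishes almost everywhere is constant. -/
lemma LocallyAbsolutelyContinuousOn.eq_of_ae_hasMFDerivAt_zero [IsManifold 𝓘(ℝ, E) 1 G]
    {g : ℝ → G} {J : Set ℝ} (hJ : J.OrdConnected)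
    (hg : LocallyAbsolutelyContinuousOn (E := E) g J)
    (h : ∀ᵐ t, t ∈ J → HasMFDerivAt 𝓘(ℝ, ℝ) 𝓘(ℝ, E) g t (0 : ℝ →L[ℝ] E))
    {s t : ℝ} (hs : s ∈ J) (ht : t ∈ J) : g s = g t := by
  -- On the connected set J, it suffices that the curve is locally constant, which can be checked in
  -- one chart.
  refine hJ.isPreconnected.induction₂ (fun a b => g a = g b) (fun a ha => ?_)
    (fun _ _ _ _ _ _ => Eq.trans) (fun _ _ _ _ => Eq.symm) hs ht
  have hsrc := (hg.1 a ha).preimage_mem_nhdsWithin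
    (extChartAt_source_mem_nhds (I := 𝓘(ℝ, E)) (g a))
  obtain ⟨ε, hε, hball⟩ := Metric.mem_nhdsWithin_iff.1 hsrc
  have hC : (Metric.ball a ε ∩ J).OrdConnected :=
    (convex_ball a ε).ordConnected.inter hJ
  have key : ∀ x ∈ Metric.ball a ε ∩ J, ∀ y ∈ Metric.ball a ε ∩ J, x ≤ y → g x = g y := by
    intro x hx y hy hxy
    have hsub := hC.out hx hy
    have hmaps : MapsTo g (Icc x y) (extChartAt 𝓘(ℝ, E) (g a)).source :=
      fun z hz => hball (hsub hz)
    obtain ⟨c, hc⟩ := (hg.2 (g a) x y hxy (hsub.trans inter_subset_right)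
      hmaps).const_of_ae_hasDerivAt_zero (by
        filter_upwards [h] with z hz hzxy
        rw [uIcc_of_le hxy] at hzxy
        have hzs := hmaps hzxy
        rw [extChartAt_source] at hzs
        have h1 := (mdifferentiableAt_extChartAt (I := 𝓘(ℝ, E)) hzs).hasMFDerivAt.comp z
          (hz (hsub hzxy).2)
        let D : E →L[ℝ] E := mfderiv 𝓘(ℝ, E) 𝓘(ℝ, E) (extChartAt 𝓘(ℝ, E) (g a)) (g z)
        have h2 : HasFDerivAt (fun s => extChartAt 𝓘(ℝ, E) (g a) (g s))
            (D.comp (0 : ℝ →L[ℝ] E)) z := h1.hasFDerivAt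
        simpa using h2.hasDerivAt)
    refine (extChartAt 𝓘(ℝ, E) (g a)).injOn (hmaps (left_mem_Icc.2 hxy))
      (hmaps (right_mem_Icc.2 hxy)) ?_
    exact (hc x left_mem_uIcc).trans (hc y right_mem_uIcc).symm
  filter_upwards [inter_mem_nhdsWithin J (Metric.ball_mem_nhds a hε)] with b hb
  have ha' : a ∈ Metric.ball a ε ∩ J := ⟨Metric.mem_ball_self hε, ha⟩
  rcases le_total a b with hab | hab
  · exact key a ha' b hb.symm hab
  · exact (key b hb.symm a ha' hab).symm

lemma image_controlRegion [Group G] {p : Submodule ℝ (GroupLieAlgebra 𝓘(ℝ, E) G)}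
    (F : Seminorm ℝ p) (g : G) (ψ : TangentSpace 𝓘(ℝ, E) g →L[ℝ] ℝ) :
    hamiltonian g ψ '' controlRegion F =
      ((bodyCovector g ψ).comp p.subtype) '' {v | F v ≤ 1} := by
  ext x
  constructor
  · rintro ⟨v, ⟨hv, hF⟩, rfl⟩
    exact ⟨⟨v, hv⟩, hF, rfl⟩
  · rintro ⟨v, hF, rfl⟩
    exact ⟨v, ⟨v.2, hF⟩, rfl⟩

end SubFinsler

end

theorem theorem2p4
    {E : Type*} [NormedAddCommGroup E] [NormedSpace ℝ E] [FiniteDimensional ℝ E]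
    {G : Type*} [TopologicalSpace G] [ChartedSpace E G] [Group G] [LieGroup 𝓘(ℝ, E) ∞ G]
    [T2Space G] [ConnectedSpace G]
    (hdim : Module.finrank ℝ E = 3)
    (p : Submodule ℝ (GroupLieAlgebra 𝓘(ℝ, E) G))
    (hp : SubFinsler.Generates p) (hp2 : 2 ≤ Module.finrank ℝ p)
    (F : Seminorm ℝ p) (hF : ∀ v : p, F v = 0 → v = 0)
    (J : Set ℝ) (hJ : J.OrdConnected)
    (g : ℝ → G) (u : ℝ → GroupLieAlgebra 𝓘(ℝ, E) G)
    (ψ : ∀ t : ℝ, TangentSpace 𝓘(ℝ, E) (g t) →L[ℝ] ℝ)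
    (hext : SubFinsler.IsExtremal F J g u ψ)
    (hconst : ∃ s ∈ J, ∃ t ∈ J, g s ≠ g t) :
    SubFinsler.IsNormal F J g ψ ∧ ¬ SubFinsler.IsAbnormal F J g ψ := by
  have : LieGroup 𝓘(ℝ, E) (minSmoothness ℝ 3) G :=
    LieGroup.of_le (n := ∞) (by simpa using (ENat.LEInfty.out : (3 : ℕ∞ω) ≤ ∞))
  have : IsManifold 𝓘(ℝ, E) 1 G := IsManifold.of_le (n := ∞) (by simp)
  have : CompleteSpace E := FiniteDimensional.complete ℝ E
  have : FiniteDimensional ℝ (GroupLieAlgebra 𝓘(ℝ, E) G) :=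
    inferInstanceAs (FiniteDimensional ℝ E)
  obtain ⟨a, ha, b, hb, hab⟩ := hconst
  have hder : ∀ᵐ t, t ∈ J → ∀ v, HasDerivAt (fun s => SubFinsler.hamiltonian (g s) (ψ s) v)
      (SubFinsler.hamiltonian (g t) (ψ t) ⁅u t, v⁆) t := by
    filter_upwards [hext.velocity, hext.adjoint] with t hvel hadj htJ v
    exact SubFinsler.hasDerivAt_hamiltonian (hvel htJ)
      (hadj htJ (g t) (mem_extChartAt_source (g t))) v
  obtain ⟨M, hM⟩ := SubFinsler.exists_const_isGreatest F hF hJ ⟨a, ha⟩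
    (fun t => (SubFinsler.bodyCovector (g t) (ψ t)).comp p.subtype)
    (fun v x y hxy hsub => hext.covector_absolutelyContinuous v x y hxy hsub) (by
      filter_upwards [hder, hext.maximum] with t hd hmax htJ
      obtain ⟨hup, huF⟩ := hext.control_mem t htJ
      refine ⟨⟨u t, hup⟩, huF, fun v hv => hmax htJ v ⟨v.2, hv⟩, ?_⟩
      have h0 : SubFinsler.hamiltonian (g t) (ψ t) ⁅u t, u t⁆ = 0 := by
        rw [lie_self]
        exact (SubFinsler.bodyCovector (g t) (ψ t)).map_zero
      exact h0 ▸ hd htJ (u t))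
  simp only [← SubFinsler.image_controlRegion] at hM
  have hM0 : 0 ≤ M := (hM a ha).2 ⟨0, ⟨p.zero_mem, (map_zero F).trans_le zero_le_one⟩,
    (SubFinsler.bodyCovector (g a) (ψ a)).map_zero⟩
  have hMpos : 0 < M := by
    refine hM0.lt_of_ne' fun hM0 => hab ?_
    subst hM0
    have hzero : ∀ t ∈ J, ∀ v ∈ p, SubFinsler.hamiltonian (g t) (ψ t) v = 0 := by
      intro t ht v hv
      have := SubFinsler.eq_zero_of_nonpos_unitBall F
        ((SubFinsler.bodyCovector (g t) (ψ t)).comp p.subtype)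
        fun w hw => (hM t ht).2 ⟨w, ⟨w.2, hw⟩, rfl⟩
      exact LinearMap.congr_fun this ⟨v, hv⟩
    -- λ(v) is known to vanish only on J, so derivatives are compared within J. They are unique
    -- there, endpoints included, because the nontrivial interval between a and b lies in J.
    have hJd : UniqueDiffOn ℝ J := by
      refine uniqueDiffOn_convex hJ.convex ?_
      have hne : a ≠ b := fun h => hab (congrArg g h)
      have hsub : uIcc a b ⊆ J := hJ.uIcc_subset ha hb
      refine Set.Nonempty.mono (interior_mono hsub) ?_
      rw [uIcc, interior_Icc]
      exact nonempty_Ioo.2 (by simpa using hne.symm)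
    refine hext.absolutelyContinuous.eq_of_ae_hasMFDerivAt_zero hJ ?_ ha hb
    filter_upwards [hder, hext.velocity] with t hd hvel htJ
    have hu0 : u t = 0 := by
      refine SubFinsler.eq_zero_of_functional_lie_eq_zero hdim hp hp2
        (SubFinsler.bodyCovector_ne_zero (hext.covector_ne_zero t htJ)) (hzero t htJ)
        (hext.control_mem t htJ).1 fun v hv => ?_
      refine (hJd t htJ).eq_deriv J (hd htJ v).hasDerivWithinAt ?_
      exact (hasDerivWithinAt_const t J (0 : ℝ)).congr (fun s hs => hzero s hs v hv)
        (hzero t htJ v hv)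
    have h := hvel htJ
    have h0 : (mulInvariantVectorField (0 : GroupLieAlgebra 𝓘(ℝ, E) G) (g t)) = 0 :=
      map_zero (mfderiv 𝓘(ℝ, E) 𝓘(ℝ, E) (g t * ·) (1 : G))
    rw [hu0, h0] at h
    exact h.congr_mfderiv (ContinuousLinearMap.smulRight_zero (M₂ := E) (1 : ℝ →L[ℝ] ℝ))
  exact ⟨⟨M, hMpos, hM⟩, fun h => hMpos.ne' ((hM a ha).unique (h a ha))⟩
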